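/- Let $n\ge 0$ be an integer. Let $P_3(n)$ denote the number of partitions of $n$ into distinct parts, each congruent to $-2^3,-2^2,-2^1$ or $-2^0 \pmod{15}$. Let $G_3(n)$ denote the number of partitions of $n$ satisfying all of the following conditions: (i) no part is $\equiv 2^3,2^2,2^1$ or $2^0\pmod{15}$; (ii) any two parts that are not multiples of $15$ differ by at least $15$, with equality only if a part is $\equiv -2^3,-2^2,-2^1$ or $-2^0\pmod{15}$; (iii) every part that is $\not\equiv -2^3,-2^2,-2^1,-2^0\pmod{15}$ is $>15$; (iv) any two parts that are multiples of $15$ differ by at least $60$; (v) if some part is a multiple of $15$, then the smallest such part is $\ge 30+30\tau$ if $7$ is a part, and $\ge 45+30\tau$ otherwise, where $\tau$ is the number of parts that are not multiples of $15$. Then $G_3(n)=P_3(n)$. -/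

import Mathlib

/-- `m` lies in one of the classes `-2^3, -2^2, -2^1, -2^0` modulo `15`. -/
def IsNegPowClass (m : ℕ) : Prop :=
  (m : ℤ) ≡ -2 ^ 3 [ZMOD 15] ∨ (m : ℤ) ≡ -2 ^ 2 [ZMOD 15] ∨
    (m : ℤ) ≡ -2 ^ 1 [ZMOD 15] ∨ (m : ℤ) ≡ -2 ^ 0 [ZMOD 15]

instance (m : ℕ) : Decidable (IsNegPowClass m) := by
  unfold IsNegPowClass; infer_instance

/-- `m` lies in one of the classes `2^3, 2^2, 2^1, 2^0` modulo `15`. -/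
def IsPosPowClass (m : ℕ) : Prop :=
  (m : ℤ) ≡ 2 ^ 3 [ZMOD 15] ∨ (m : ℤ) ≡ 2 ^ 2 [ZMOD 15] ∨
    (m : ℤ) ≡ 2 ^ 1 [ZMOD 15] ∨ (m : ℤ) ≡ 2 ^ 0 [ZMOD 15]

instance (m : ℕ) : Decidable (IsPosPowClass m) := by
  unfold IsPosPowClass; infer_instance

/-- The parts are distinct and all lie in the classes `-2^3, -2^2, -2^1, -2^0` modulo `15`. -/
def IsPThree (s : Multiset ℕ) : Prop :=
  s.Nodup ∧ ∀ x ∈ s, IsNegPowClass x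

instance (s : Multiset ℕ) : Decidable (IsPThree s) := by
  unfold IsPThree; infer_instance

/-- The sub-multiset of the parts that are multiples of `15`. -/
def multiplesPart (s : Multiset ℕ) : Multiset ℕ := s.filter (fun x => 15 ∣ x)

/-- The sub-multiset of the parts that are not multiples of `15`. -/
def nonMultiplesPart (s : Multiset ℕ) : Multiset ℕ := s.filter (fun x => ¬ 15 ∣ x)

/-- The difference and congruence conditions on a multiset of parts. Two parts of a multiset `t`
are given as `x ∈ t` and `y ∈ t.erase x`, so that repeated parts count as parts with
difference `0`. -/
structure IsGThree (s : Multiset ℕ) : Prop where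
  /-- No part is congruent to `2^3, 2^2, 2^1` or `2^0` modulo `15`. -/
  not_pos : ∀ x ∈ s, ¬ IsPosPowClass x
  /-- Parts that are not multiples of `15` differ by at least `15`, with equality only if a part
  (equivalently, each of the two) is in a class `-2^3, -2^2, -2^1, -2^0`. -/
  gap : ∀ x ∈ nonMultiplesPart s, ∀ y ∈ (nonMultiplesPart s).erase x, x ≤ y →
    x + 15 ≤ y ∧ (y = x + 15 → IsNegPowClass x ∨ IsNegPowClass y)
  /-- Parts outside the classes `-2^3, -2^2, -2^1, -2^0` exceed `15`. -/
  large : ∀ x ∈ s, ¬ IsNegPowClass x → 15 < x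
  /-- Multiples of `15` differ by at least `60`. -/
  gap_mult : ∀ x ∈ multiplesPart s, ∀ y ∈ (multiplesPart s).erase x, x ≤ y → x + 60 ≤ y
  /-- The lower bound for the multiples of `15`. -/
  lower : ∀ x ∈ multiplesPart s,
    (if 7 ∈ s then 30 else 45) + 30 * (nonMultiplesPart s).card ≤ x

instance (s : Multiset ℕ) : Decidable (IsGThree s) :=
  decidable_of_iff
    ((∀ x ∈ s, ¬ IsPosPowClass x) ∧
      (∀ x ∈ nonMultiplesPart s, ∀ y ∈ (nonMultiplesPart s).erase x, x ≤ y →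
        x + 15 ≤ y ∧ (y = x + 15 → IsNegPowClass x ∨ IsNegPowClass y)) ∧
      (∀ x ∈ s, ¬ IsNegPowClass x → 15 < x) ∧
      (∀ x ∈ multiplesPart s, ∀ y ∈ (multiplesPart s).erase x, x ≤ y → x + 60 ≤ y) ∧
      (∀ x ∈ multiplesPart s,
        (if 7 ∈ s then 30 else 45) + 30 * (nonMultiplesPart s).card ≤ x))
    ⟨fun ⟨h1, h2, h3, h4, h5⟩ => ⟨h1, h2, h3, h4, h5⟩,
      fun ⟨h1, h2, h3, h4, h5⟩ => ⟨h1, h2, h3, h4, h5⟩⟩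

/-- The number of partitions of `n` into distinct parts congruent to `-2^3, -2^2, -2^1` or
`-2^0` modulo `15`. -/
def PThree (n : ℕ) : ℕ :=
  (Finset.univ.filter (fun p : Nat.Partition n => IsPThree p.parts)).card

/-- The number of partitions of `n` satisfying the difference and congruence conditions. -/
def GThree (n : ℕ) : ℕ :=
  (Finset.univ.filter (fun p : Nat.Partition n => IsGThree p.parts)).card

/-! Put `p = q ^ 15` and a = q^7, b = q^11, c = q^13, d = q^14 (the primary colours). The other
admissible residues that are nonzero modulo 15 are those of the six products ab, ..., cd (the
secondary colours), and abcd = p²ε with ε = p (the multiples of 15).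

Gap side. Lowering the parts outside 15ℤ by 0, 15, 30, ... from the smallest up makes the primary
ones repeatable and leaves the secondary ones distinct. So i such parts contribute `p ^ (i.choose
2)` times a coefficient of Y^i in an infinite product. Each multiple of 15 is counted as Y^2: its
bounds, which depend on τ, are exactly what turns `i.choose 2` into `(i + 2 * k).choose 2`. Hence
the generating function of `GThree` is the image of a series in Y under the functional Y^n ↦ `p ^
(n.choose 2)`. The requirement that secondary parts exceed 15 and the role of the part 7 multiply
the product by a polynomial, `corr` divided by p (`K_p_mul_gapSeries`).

Product side. With a, b, c, d, ε free subject to abcd = p²ε, let F be the image of `corr *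
fullProd`. The functional kills h(pY) - Y h(Y), and an explicit telescoping certificate
(`cert_identity`, `corr_mul_fullProd_sub`) gives F(a,b,c,d,ε) = (1 + a) F(b,c,d,ap,εp). Iterating
drives all parameters to 0, where F = p, so F is p times the product of all 1 + a p^t, ..., 1 + d
p^t (`lam_corr_mul_fullProd`). To keep sums finite, the functional is truncated and the argument
runs modulo powers of p. -/

namespace GollnitzFour

/-! ### Euler's series in Y over ℤ[[q]] -/

/-- The variable of the generating functions of partitions. -/
noncomputable def q : PowerSeries ℤ := PowerSeries.X

/-- The base `q ^ 15` of the `q`-series. -/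
noncomputable def p : PowerSeries ℤ := q ^ 15

/-- `1 / ((1 - p) (1 - p ^ 2) ⋯ (1 - p ^ n))`. -/
noncomputable def invPoch : ℕ → PowerSeries ℤ
  | 0 => 1
  | n + 1 => invPoch n * PowerSeries.invOfUnit (1 - p ^ (n + 1)) 1

theorem one_sub_p_pow_mul_invPoch (n : ℕ) :
    (1 - p ^ (n + 1)) * invPoch (n + 1) = invPoch n := by
  have h : (1 - p ^ (n + 1)) * PowerSeries.invOfUnit (1 - p ^ (n + 1)) 1 = 1 := by
    apply PowerSeries.mul_invOfUnit
    simp [p, q]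
  rw [invPoch, mul_left_comm, h, mul_one]

theorem p_ne_zero : p ≠ 0 := by
  simp [p, q, PowerSeries.X_ne_zero]

theorem one_sub_p_pow_ne_zero (n : ℕ) : (1 - p ^ (n + 1)) ≠ 0 := by
  intro h
  have := congrArg (PowerSeries.constantCoeff (R := ℤ)) h
  simp [p, q] at this

/-- The indeterminate marking the number of parts. -/
noncomputable abbrev Y : PowerSeries (PowerSeries ℤ) := PowerSeries.X

/-- Constants in the ring of power series in `Y`. -/
noncomputable abbrev K : PowerSeries ℤ →+* PowerSeries (PowerSeries ℤ) := PowerSeries.C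

/-- Euler's series of the infinite product `∏ (1 + c p ^ t Y)`. -/
noncomputable def prodSeries (c : PowerSeries ℤ) : PowerSeries (PowerSeries ℤ) :=
  PowerSeries.mk fun n => p ^ (n.choose 2) * c ^ n * invPoch n

/-- Euler's series of the infinite product `∏ 1 / (1 - c p ^ t Y)`. -/
noncomputable def invSeries (c : PowerSeries ℤ) : PowerSeries (PowerSeries ℤ) :=
  PowerSeries.mk fun n => c ^ n * invPoch n

/-- Euler's series of the infinite product `∏ 1 / (1 - c p ^ t Y ^ 2)`. -/
noncomputable def invSqSeries (c : PowerSeries ℤ) : PowerSeries (PowerSeries ℤ) :=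
  PowerSeries.mk fun n => if Even n then c ^ (n / 2) * invPoch (n / 2) else 0

/-- Splits off the factor t = 0 of the infinite product. Coefficientwise this is the recursion of
`invPoch`. -/
theorem prodSeries_eq (c : PowerSeries ℤ) :
    prodSeries c = (1 + K c * Y) * prodSeries (c * p) := by
  ext1 n
  rcases n with _ | n
  · simp [prodSeries, add_mul, mul_assoc]
  · simp only [prodSeries, add_mul, one_mul, mul_assoc, map_add, PowerSeries.coeff_C_mul,
      PowerSeries.coeff_succ_X_mul, PowerSeries.coeff_mk, Nat.choose_succ_succ' n 1,
      Nat.choose_one_right]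
    rw [← one_sub_p_pow_mul_invPoch n]
    ring

theorem invSeries_eq (c : PowerSeries ℤ) :
    (1 - K c * Y) * invSeries c = invSeries (c * p) := by
  ext1 n
  rcases n with _ | n
  · simp [invSeries, sub_mul, mul_assoc]
  · simp only [invSeries, sub_mul, one_mul, mul_assoc, map_sub, PowerSeries.coeff_C_mul,
      PowerSeries.coeff_succ_X_mul, PowerSeries.coeff_mk]
    rw [← one_sub_p_pow_mul_invPoch n]
    ring

theorem invSqSeries_eq (c : PowerSeries ℤ) :
    (1 - K c * Y ^ 2) * invSqSeries c = invSqSeries (c * p) := by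
  ext1 n
  rcases n with _ | _ | n
  · simp [invSqSeries, sub_mul, mul_assoc]
  · simp [invSqSeries, sub_mul, mul_assoc, PowerSeries.coeff_X_pow_mul']
  · have h : (n + 1 + 1) / 2 = n / 2 + 1 := by omega
    have h2 : Even (n + 1 + 1) ↔ Even n := by simp [Nat.even_add_one]
    have hc : ∀ f : PowerSeries (PowerSeries ℤ),
        PowerSeries.coeff (n + 1 + 1) (Y ^ 2 * f) = PowerSeries.coeff n f := fun f =>
      PowerSeries.coeff_X_pow_mul f 2 n
    simp only [invSqSeries, sub_mul, one_mul, mul_assoc, map_sub, PowerSeries.coeff_C_mul,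
      hc, PowerSeries.coeff_mk, h, h2]
    split_ifs
    · rw [← one_sub_p_pow_mul_invPoch (n / 2)]
      ring
    · simp

theorem rescale_prodSeries (c : PowerSeries ℤ) :
    PowerSeries.rescale p (prodSeries c) = prodSeries (c * p) := by
  ext1 n
  simp only [prodSeries, PowerSeries.coeff_rescale, PowerSeries.coeff_mk]
  ring

theorem rescale_invSeries (c : PowerSeries ℤ) :
    PowerSeries.rescale p (invSeries c) = invSeries (c * p) := by
  ext1 n
  simp only [invSeries, PowerSeries.coeff_rescale, PowerSeries.coeff_mk]
  ring

/-- Y ↦ pY multiplies Y² by p², so two factors of the product are lost, not one. -/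
theorem rescale_invSqSeries (c : PowerSeries ℤ) :
    PowerSeries.rescale p (invSqSeries c) = invSqSeries (c * p * p) := by
  ext1 n
  simp only [invSqSeries, PowerSeries.coeff_rescale, PowerSeries.coeff_mk]
  split_ifs with h
  · obtain ⟨m, rfl⟩ := h
    have : (m + m) / 2 = m := by omega
    rw [this]
    ring
  · simp

section Map
variable {S : Type*} [CommRing S] (φ : PowerSeries ℤ →+* S) {c : PowerSeries ℤ}

theorem map_prodSeries_of_eq_zero (h : φ c = 0) : (prodSeries c).map φ = 1 := by
  ext1 n
  rcases n with _ | n <;> simp [prodSeries, h, invPoch, PowerSeries.coeff_one]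

theorem map_invSeries_of_eq_zero (h : φ c = 0) : (invSeries c).map φ = 1 := by
  ext1 n
  rcases n with _ | n <;> simp [invSeries, h, invPoch, PowerSeries.coeff_one]

theorem map_invSqSeries_of_eq_zero (h : φ c = 0) : (invSqSeries c).map φ = 1 := by
  ext1 n
  rcases n with _ | _ | n
  · simp [invSqSeries, invPoch]
  · simp [invSqSeries, PowerSeries.coeff_one]
  · have h' : (n + 1 + 1) / 2 = n / 2 + 1 := by omega
    simp only [invSqSeries, PowerSeries.coeff_map, PowerSeries.coeff_mk, h']
    split_ifs <;> simp [h, PowerSeries.coeff_one]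

end Map

/-! ### The coloured product and its telescoping certificate -/

/-- The product over the primary and secondary colours. -/
noncomputable def colourProd (a b c d : PowerSeries ℤ) : PowerSeries (PowerSeries ℤ) :=
  prodSeries (a * b) * prodSeries (a * c) * prodSeries (a * d) * prodSeries (b * c) *
    prodSeries (b * d) * prodSeries (c * d) *
    (invSeries a * invSeries b * invSeries c * invSeries d)

/-- The product over all colours. -/
noncomputable def fullProd (a b c d ε : PowerSeries ℤ) : PowerSeries (PowerSeries ℤ) :=
  colourProd a b c d * invSqSeries ε

/-- The polynomial factor correcting the boundary conditions, multiplied by `p`. -/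
noncomputable def corr (a b c d ε : PowerSeries ℤ) : PowerSeries (PowerSeries ℤ) :=
  K p + K (a * b * c + a * b * d + a * c * d + b * c * d - p * ε) * Y ^ 2 +
    K (p * ε * (a + b + c + d - p)) * Y ^ 3 + K (p ^ 2 * ε ^ 2) * Y ^ 5

/-- The symmetry in the colours lets a single functional equation, stated for the first parameter,
serve for all four in turn. -/
theorem colourProd_rotate (a b c d : PowerSeries ℤ) :
    colourProd a b c d = colourProd b c d a := by
  simp only [colourProd, mul_comm b a, mul_comm c a, mul_comm d a]
  ring

theorem corr_rotate (a b c d ε : PowerSeries ℤ) : corr a b c d ε = corr b c d a ε := by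
  simp only [corr]
  ring_nf

/-- What remains of the telescoping relation after cancelling `commonProd`: a polynomial identity
modulo the relation between the parameters. The factor p^3 clears the denominators of 1 + bcx/p, 1 +
bdx/p and 1 + cdx/p. -/
theorem cert_identity {R : Type*} [CommRing R] {a b c d x p ε : R}
    (h : a * b * c * d = p ^ 2 * ε) :
    p ^ 3 * ((p + (a * b * c + a * b * d + a * c * d + b * c * d - p * ε) * x ^ 2 +
        p * ε * (a + b + c + d - p) * x ^ 3 + p ^ 2 * ε ^ 2 * x ^ 5) *
          ((1 + a * b * x) * (1 + a * c * x) * (1 + a * d * x)) -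
      (1 + a) * ((1 - a * x) * (1 - ε * x ^ 2)) *
        (p + (a * p * b * c + a * p * b * d + a * p * c * d + b * c * d - p * (ε * p)) * x ^ 2 +
        p * (ε * p) * (a * p + b + c + d - p) * x ^ 3 + p ^ 2 * (ε * p) ^ 2 * x ^ 5)) =
    -a * p * (p ^ 3 * ((1 - a * x) * (1 - b * x) * (1 - c * x) * (1 - d * x) *
        ((1 - ε * p * x ^ 2) * (1 - ε * x ^ 2))) -
      x * ((1 + a * b * x) * (1 + a * c * x) * (1 + a * d * x)) *
        ((p + b * c * x) * (p + b * d * x) * (p + c * d * x))) := by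
  grind

/-- The telescoping factor. -/
noncomputable def cert (a b c d ε : PowerSeries ℤ) : PowerSeries (PowerSeries ℤ) :=
  fullProd a b c d ε * ((K p + K (b * c) * Y) * (K p + K (b * d) * Y) * (K p + K (c * d) * Y))

/-- The common factor of `fullProd a b c d ε` and `fullProd (a * p) b c d (ε * p)`. -/
noncomputable def commonProd (a b c d ε : PowerSeries ℤ) : PowerSeries (PowerSeries ℤ) :=
  prodSeries (a * b * p) * prodSeries (a * c * p) * prodSeries (a * d * p) * prodSeries (b * c) *
    prodSeries (b * d) * prodSeries (c * d) *
    (invSeries a * invSeries b * invSeries c * invSeries d) * invSqSeries ε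

theorem fullProd_eq_mul_commonProd (a b c d ε : PowerSeries ℤ) :
    fullProd a b c d ε =
      (1 + K a * K b * Y) * (1 + K a * K c * Y) * (1 + K a * K d * Y) *
        commonProd a b c d ε := by
  rw [fullProd, colourProd, commonProd, prodSeries_eq (a * b), prodSeries_eq (a * c),
    prodSeries_eq (a * d)]
  simp only [map_mul]
  ac_rfl

theorem fullProd_mul_p_eq_mul_commonProd (a b c d ε : PowerSeries ℤ) :
    fullProd (a * p) b c d (ε * p) =
      ((1 - K a * Y) * (1 - K ε * Y ^ 2)) * commonProd a b c d ε := by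
  have e1 : a * p * b = a * b * p := by ring
  have e2 : a * p * c = a * c * p := by ring
  have e3 : a * p * d = a * d * p := by ring
  rw [fullProd, colourProd, commonProd, e1, e2, e3, ← invSeries_eq a, ← invSqSeries_eq ε]
  ac_rfl

theorem rescale_K (x : PowerSeries ℤ) : PowerSeries.rescale p (K x) = K x := by
  ext1 n
  rcases n with _ | n <;> simp [PowerSeries.coeff_C]

theorem rescale_fullProd_mul (a b c d ε : PowerSeries ℤ) :
    (1 + K b * K c * Y) * (1 + K b * K d * Y) * (1 + K c * K d * Y) *
        PowerSeries.rescale p (fullProd a b c d ε) =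
      (1 - K a * Y) * (1 - K b * Y) * (1 - K c * Y) * (1 - K d * Y) *
        ((1 - K ε * K p * Y ^ 2) * (1 - K ε * Y ^ 2)) * commonProd a b c d ε := by
  rw [fullProd, colourProd, commonProd]
  simp only [map_mul (PowerSeries.rescale p), rescale_prodSeries, rescale_invSeries,
    rescale_invSqSeries]
  rw [← invSqSeries_eq (ε * p), ← invSqSeries_eq ε, ← invSeries_eq a, ← invSeries_eq b,
    ← invSeries_eq c, ← invSeries_eq d, prodSeries_eq (b * c), prodSeries_eq (b * d),
    prodSeries_eq (c * d)]
  simp only [map_mul K]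
  generalize prodSeries (a * b * p) = Dab, prodSeries (a * c * p) = Dac,
    prodSeries (a * d * p) = Dad, prodSeries (b * c * p) = Dbc, prodSeries (b * d * p) = Dbd,
    prodSeries (c * d * p) = Dcd, invSeries a = Ea, invSeries b = Eb, invSeries c = Ec,
    invSeries d = Ed, invSqSeries ε = F
  generalize 1 - K a * Y = ya, 1 - K b * Y = yb, 1 - K c * Y = yc, 1 - K d * Y = yd,
    1 - K ε * Y ^ 2 = ye, 1 - K ε * K p * Y ^ 2 = yf, 1 + K b * K c * Y = ybc,
    1 + K b * K d * Y = ybd, 1 + K c * K d * Y = ycd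
  ring

/-- Under Y ↦ pY the extra factor p + bcY becomes p(1 + bcY), which restores the factor that the
rescaled `prodSeries (b * c)` has lost; likewise for bd and cd. -/
theorem rescale_cert (a b c d ε : PowerSeries ℤ) :
    PowerSeries.rescale p (cert a b c d ε) = K p ^ 3 *
      ((1 - K a * Y) * (1 - K b * Y) * (1 - K c * Y) * (1 - K d * Y) *
        ((1 - K ε * K p * Y ^ 2) * (1 - K ε * Y ^ 2)) * commonProd a b c d ε) := by
  rw [← rescale_fullProd_mul, cert]
  simp only [map_mul (PowerSeries.rescale p), map_add (PowerSeries.rescale p), rescale_K,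
    PowerSeries.rescale_X, map_mul K]
  generalize PowerSeries.rescale p (fullProd a b c d ε) = F
  ring

theorem corr_mul_fullProd_sub {a b c d ε : PowerSeries ℤ} (h : a * b * c * d = p ^ 2 * ε) :
    K (p ^ 3) * (corr a b c d ε * fullProd a b c d ε -
      K (1 + a) * (corr (a * p) b c d (ε * p) * fullProd (a * p) b c d (ε * p))) =
    K (-a * p) * (PowerSeries.rescale p (cert a b c d ε) - Y * cert a b c d ε) := by
  have hK : K a * K b * K c * K d = K p ^ 2 * K ε := by simpa using congrArg K h
  have key := cert_identity (x := Y) hK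
  have hc : corr a b c d ε = K p + (K a * K b * K c + K a * K b * K d + K a * K c * K d +
      K b * K c * K d - K p * K ε) * Y ^ 2 + K p * K ε * (K a + K b + K c + K d - K p) * Y ^ 3 +
      K p ^ 2 * K ε ^ 2 * Y ^ 5 := by
    simp only [corr, map_add, map_sub, map_mul, map_pow]
  have hc' : corr (a * p) b c d (ε * p) = K p + (K a * K p * K b * K c + K a * K p * K b * K d +
      K a * K p * K c * K d + K b * K c * K d - K p * (K ε * K p)) * Y ^ 2 +
      K p * (K ε * K p) * (K a * K p + K b + K c + K d - K p) * Y ^ 3 +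
      K p ^ 2 * (K ε * K p) ^ 2 * Y ^ 5 := by
    simp only [corr, map_add, map_sub, map_mul, map_pow]
  rw [rescale_cert, cert, fullProd_mul_p_eq_mul_commonProd, fullProd_eq_mul_commonProd]
  rw [← hc, ← hc'] at key
  simp only [map_add, map_mul, map_one, map_pow, map_neg]
  generalize (1 + K a * K b * Y) * (1 + K a * K c * Y) * (1 + K a * K d * Y) = u at *
  generalize (K p + K b * K c * Y) * (K p + K b * K d * Y) * (K p + K c * K d * Y) = v at *
  generalize (1 - K a * Y) * (1 - K b * Y) * (1 - K c * Y) * (1 - K d * Y) *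
    ((1 - K ε * K p * Y ^ 2) * (1 - K ε * Y ^ 2)) = w at *
  generalize (1 - K a * Y) * (1 - K ε * Y ^ 2) = r at *
  linear_combination commonProd a b c d ε * key

/-! ### The functional Y^n ↦ p^(n choose 2) and the functional equation -/

/-- Truncation to degree less than `B` of the functional `Y ^ n ↦ p ^ (n.choose 2)`. -/
noncomputable def lam (B : ℕ) (h : PowerSeries (PowerSeries ℤ)) : PowerSeries ℤ :=
  ∑ n ∈ Finset.range B, p ^ (n.choose 2) * PowerSeries.coeff n h

theorem lam_sub (B : ℕ) (g h : PowerSeries (PowerSeries ℤ)) :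
    lam B (g - h) = lam B g - lam B h := by
  simp [lam, mul_sub, Finset.sum_sub_distrib]

theorem lam_K_mul (B : ℕ) (c : PowerSeries ℤ) (h : PowerSeries (PowerSeries ℤ)) :
    lam B (K c * h) = c * lam B h := by
  simp only [lam, PowerSeries.coeff_C_mul, Finset.mul_sum]
  exact Finset.sum_congr rfl fun n _ => by ring

/-- Since n.choose 2 + n = (n+1).choose 2, rescaling by p and multiplying by Y agree under the
functional. Truncation leaves only the top term. -/
theorem lam_rescale (B : ℕ) (h : PowerSeries (PowerSeries ℤ)) :
    lam (B + 1) (PowerSeries.rescale p h) =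
      lam (B + 1) (Y * h) + p ^ ((B + 1).choose 2) * PowerSeries.coeff B h := by
  have h1 : ∀ n, p ^ (n.choose 2) * PowerSeries.coeff n (PowerSeries.rescale p h) =
      p ^ ((n + 1).choose 2) * PowerSeries.coeff n h := by
    intro n
    rw [PowerSeries.coeff_rescale, Nat.choose_succ_succ' n 1, Nat.choose_one_right]
    ring
  simp only [lam, h1]
  rw [Finset.sum_range_succ, Finset.sum_range_succ' _ B]
  simp [PowerSeries.coeff_succ_X_mul]

theorem lam_corr_mul_fullProd_step (m : ℕ) {a b c d ε : PowerSeries ℤ}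
    (h : a * b * c * d = p ^ 2 * ε) :
    p ^ m ∣ lam (m + 4) (corr a b c d ε * fullProd a b c d ε) -
      (1 + a) * lam (m + 4) (corr b c d (a * p) (ε * p) * fullProd b c d (a * p) (ε * p)) := by
  have key := congrArg (lam (m + 4)) (corr_mul_fullProd_sub h)
  rw [lam_K_mul, lam_K_mul, lam_sub, lam_sub, lam_K_mul, lam_rescale, add_sub_cancel_left,
    corr_rotate (a * p), fullProd, fullProd, colourProd_rotate (a * p), ← fullProd,
    ← fullProd] at key
  have h3 : p ^ 3 ≠ 0 := pow_ne_zero 3 p_ne_zero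
  rw [← mul_dvd_mul_iff_left h3, key, ← pow_add]
  -- The truncation error carries p to the power (m+4).choose 2 ≥ m + 3; three of these factors pay
  -- for the cancelled p^3.
  refine Dvd.dvd.mul_left (Dvd.dvd.mul_right (pow_dvd_pow p ?_) _) _
  rw [Nat.choose_succ_succ' (m + 3) 1, Nat.choose_one_right]
  omega

theorem map_lam_corr_mul_fullProd {S : Type*} [CommRing S] (φ : PowerSeries ℤ →+* S) (B : ℕ)
    {a b c d ε : PowerSeries ℤ} (ha : φ a = 0) (hb : φ b = 0) (hc : φ c = 0) (hd : φ d = 0)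
    (hε : φ ε = 0) : φ (lam (B + 1) (corr a b c d ε * fullProd a b c d ε)) = φ p := by
  have h : (corr a b c d ε * fullProd a b c d ε).map φ = PowerSeries.C (φ p) := by
    simp [corr, fullProd, colourProd, map_prodSeries_of_eq_zero, map_invSeries_of_eq_zero,
      map_invSqSeries_of_eq_zero, ha, hb, hc, hd, hε]
  have h' : ∀ n, φ (PowerSeries.coeff n (corr a b c d ε * fullProd a b c d ε)) =
      if n = 0 then φ p else 0 := fun n => by
    rw [← PowerSeries.coeff_map, h, PowerSeries.coeff_C]
  rw [lam, map_sum, Finset.sum_range_succ']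
  simp only [map_mul, h']
  simp

theorem lam_corr_mul_fullProd (m : ℕ) {a b c d ε : PowerSeries ℤ}
    (h : a * b * c * d = p ^ 2 * ε) :
    p ^ m ∣ lam (m + 4) (corr a b c d ε * fullProd a b c d ε) -
      p * ∏ t ∈ Finset.range m,
        ((1 + a * p ^ t) * (1 + b * p ^ t) * (1 + c * p ^ t) * (1 + d * p ^ t)) := by
  let φ := Ideal.Quotient.mk (Ideal.span {p ^ m})
  have hφ : ∀ x y : PowerSeries ℤ, p ^ m ∣ x - y ↔ φ x = φ y := fun x y => by
    rw [Ideal.Quotient.eq, Ideal.mem_span_singleton]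
  have hp : φ (p ^ m) = 0 :=
    Ideal.Quotient.eq_zero_iff_mem.2 (Ideal.mem_span_singleton_self _)
  set F : PowerSeries ℤ → PowerSeries ℤ → PowerSeries ℤ → PowerSeries ℤ → PowerSeries ℤ →
    PowerSeries ℤ := fun a b c d ε => lam (m + 4) (corr a b c d ε * fullProd a b c d ε) with hF
  have step : ∀ {a b c d ε : PowerSeries ℤ}, a * b * c * d = p ^ 2 * ε →
      φ (F a b c d ε) = φ ((1 + a) * F b c d (a * p) (ε * p)) := fun h =>
    (hφ _ _).1 (lam_corr_mul_fullProd_step m h)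
  -- Four steps restore the order of the parameters. Each step multiplies both sides of abcd = p²ε
  -- by p, so the constraint persists.
  have steps : ∀ {a b c d ε : PowerSeries ℤ}, a * b * c * d = p ^ 2 * ε →
      φ (F a b c d ε) = φ ((1 + a) * (1 + b) * (1 + c) * (1 + d) *
        F (a * p) (b * p) (c * p) (d * p) (ε * p ^ 4)) := by
    intro a b c d ε h
    rw [step h, map_mul, step (by linear_combination p * h), map_mul,
      step (by linear_combination p ^ 2 * h), map_mul, step (by linear_combination p ^ 3 * h),
      show ε * p * p * p * p = ε * p ^ 4 by ring]
    simp only [map_mul]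
    ring
  have iter : ∀ k : ℕ, φ (F a b c d ε) = φ ((∏ t ∈ Finset.range k,
      ((1 + a * p ^ t) * (1 + b * p ^ t) * (1 + c * p ^ t) * (1 + d * p ^ t))) *
        F (a * p ^ k) (b * p ^ k) (c * p ^ k) (d * p ^ k) (ε * p ^ (4 * k))) := by
    intro k
    induction k with
    | zero => simp
    | succ k ih =>
      rw [ih, map_mul, steps (by linear_combination p ^ (4 * k) * h), Finset.prod_range_succ]
      simp only [mul_assoc, ← pow_succ, ← pow_add, ← map_mul, Nat.mul_succ]
  rw [hφ]
  have hz : ∀ x : PowerSeries ℤ, φ (x * p ^ m) = 0 := fun x => by rw [map_mul, hp, mul_zero]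
  have hε : φ (ε * p ^ (4 * m)) = 0 := by
    rw [show ε * p ^ (4 * m) = ε * p ^ (3 * m) * p ^ m by ring, hz]
  change φ (F a b c d ε) = _
  -- After m rounds every parameter is divisible by p^m, hence zero in the quotient, and only the
  -- constant term p of `corr` survives.
  rw [iter m, map_mul, hF,
    map_lam_corr_mul_fullProd φ (m + 3) (hz _) (hz _) (hz _) (hz _) hε, ← map_mul, mul_comm]

/-! ### Generating functions of families of finite sets -/

/-- The generating function of a family of finite sets of natural numbers by their sums. -/
noncomputable def gf (S : Set (Finset ℕ)) : PowerSeries ℤ :=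
  PowerSeries.mk fun n => ((S ∩ {s | ∑ x ∈ s, x = n}).ncard : ℤ)

theorem finite_sum_eq (n : ℕ) : {s : Finset ℕ | ∑ x ∈ s, x = n}.Finite := by
  refine (Finset.finite_toSet (Finset.range (n + 1)).powerset).subset fun s hs => ?_
  simp only [Finset.coe_powerset, Set.mem_preimage, Set.mem_powerset_iff, Finset.coe_subset]
  intro x hx
  have : x ≤ ∑ y ∈ s, y := Finset.single_le_sum (f := fun y => y) (fun _ _ => Nat.zero_le _) hx
  have hs' : ∑ x ∈ s, x = n := hs
  simp only [Finset.mem_range]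
  omega

theorem finite_inter_sum_eq (S : Set (Finset ℕ)) (n : ℕ) :
    (S ∩ {s | ∑ x ∈ s, x = n}).Finite := (finite_sum_eq n).subset Set.inter_subset_right

theorem gf_empty : gf ∅ = 0 := by
  ext n; simp [gf]

theorem gf_singleton_empty : gf {∅} = 1 := by
  ext n
  simp only [gf, PowerSeries.coeff_mk, PowerSeries.coeff_one]
  split_ifs with h
  · subst h
    rw [show ({∅} ∩ {s : Finset ℕ | ∑ x ∈ s, x = 0}) = {∅} by ext s; simp +contextual]
    simp
  · rw [show ({∅} ∩ {s : Finset ℕ | ∑ x ∈ s, x = n}) = ∅ by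
      ext s; simp; rintro rfl; simpa using Ne.symm h]
    simp

theorem gf_union {S T : Set (Finset ℕ)} (h : Disjoint S T) : gf (S ∪ T) = gf S + gf T := by
  ext n
  simp only [gf, PowerSeries.coeff_mk, map_add]
  rw [Set.union_inter_distrib_right, Set.ncard_union_eq
    (h.mono Set.inter_subset_left Set.inter_subset_left) (finite_inter_sum_eq _ _)
    (finite_inter_sum_eq _ _)]
  push_cast
  rfl

theorem gf_biUnion {ι : Type*} (I : Finset ι) (S : ι → Set (Finset ℕ))
    (h : (I : Set ι).PairwiseDisjoint S) : gf (⋃ i ∈ I, S i) = ∑ i ∈ I, gf (S i) := by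
  classical
  induction I using Finset.induction_on with
  | empty => simp [gf_empty]
  | insert a I ha ih =>
    rw [Finset.set_biUnion_insert, gf_union, Finset.sum_insert ha,
      ih (h.subset (by simp))]
    rw [Set.disjoint_iUnion₂_right]
    intro i hi
    exact h (by simp) (by simp [hi]) (by rintro rfl; exact ha hi)

theorem gf_image {S : Set (Finset ℕ)} {f : Finset ℕ → Finset ℕ} {m : ℕ} (hf : S.InjOn f)
    (hm : ∀ s ∈ S, ∑ x ∈ f s, x = ∑ x ∈ s, x + m) : gf (f '' S) = q ^ m * gf S := by
  ext n
  simp only [gf, q, PowerSeries.coeff_mk, PowerSeries.coeff_X_pow_mul']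
  split_ifs with h
  · rw [show f '' S ∩ {s | ∑ x ∈ s, x = n} = f '' (S ∩ {s | ∑ x ∈ s, x = n - m}) by
      ext t
      constructor
      · rintro ⟨⟨s, hs, rfl⟩, ht⟩
        refine ⟨s, ⟨hs, ?_⟩, rfl⟩
        have := hm s hs
        simp only [Set.mem_ofPred_eq] at ht ⊢
        omega
      · rintro ⟨s, ⟨hs, hs'⟩, rfl⟩
        refine ⟨⟨s, hs, rfl⟩, ?_⟩
        have := hm s hs
        simp only [Set.mem_ofPred_eq] at hs' ⊢
        omega, (hf.mono Set.inter_subset_left).ncard_image]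
  · rw [show f '' S ∩ {s | ∑ x ∈ s, x = n} = ∅ by
      ext t
      simp only [Set.mem_inter_iff, Set.mem_image, Set.mem_ofPred_eq, Set.mem_empty_iff_false,
        iff_false, not_and]
      rintro ⟨s, hs, rfl⟩ ht
      have := hm s hs
      omega]
    simp

/-- The predicate `c` recovers both pieces from a union, so unions correspond to pairs. -/
theorem gf_image2_union {S T : Set (Finset ℕ)} {c : ℕ → Prop} [DecidablePred c]
    (hS : ∀ s ∈ S, ∀ x ∈ s, ¬ c x) (hT : ∀ t ∈ T, ∀ x ∈ t, c x) :
    gf (Set.image2 (· ∪ ·) S T) = gf S * gf T := by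
  have hc : ∀ s ∈ S, ∀ t ∈ T, (s ∪ t).filter (fun x => ¬ c x) = s ∧ (s ∪ t).filter c = t := by
    intro s hs t ht
    constructor
    · ext x
      have h1 := hS s hs x
      have h2 := hT t ht x
      simp only [Finset.mem_filter, Finset.mem_union]
      tauto
    · ext x
      have h1 := hS s hs x
      have h2 := hT t ht x
      simp only [Finset.mem_filter, Finset.mem_union]
      tauto
  have hsum : ∀ s ∈ S, ∀ t ∈ T, ∑ x ∈ s ∪ t, x = ∑ x ∈ s, x + ∑ x ∈ t, x := fun s hs t ht =>
    Finset.sum_union (Finset.disjoint_left.2 fun x hx hx' => hS s hs x hx (hT t ht x hx'))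
  ext n
  rw [PowerSeries.coeff_mul]
  simp only [gf, PowerSeries.coeff_mk]
  set U : ℕ → Finset (Finset ℕ) := fun k => (finite_inter_sum_eq S k).toFinset with hU
  set W : ℕ → Finset (Finset ℕ) := fun k => (finite_inter_sum_eq T k).toFinset with hW
  have hUc : ∀ k, (S ∩ {s | ∑ x ∈ s, x = k}).ncard = (U k).card := fun k =>
    Set.ncard_eq_toFinset_card _ _
  have hWc : ∀ k, (T ∩ {s | ∑ x ∈ s, x = k}).ncard = (W k).card := fun k =>
    Set.ncard_eq_toFinset_card _ _
  have hset : Set.image2 (· ∪ ·) S T ∩ {s | ∑ x ∈ s, x = n} =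
      (((Finset.HasAntidiagonal.antidiagonal n).sigma fun k => U k.1 ×ˢ W k.2).image
        fun z => z.2.1 ∪ z.2.2 : Finset (Finset ℕ)) := by
    ext r
    simp only [Set.mem_inter_iff, Set.mem_image2, Set.mem_ofPred_eq, Finset.coe_image,
      Set.mem_image, Finset.mem_coe, Finset.mem_sigma, Finset.HasAntidiagonal.mem_antidiagonal,
      Finset.mem_product, hU, hW, Set.Finite.mem_toFinset]
    constructor
    · rintro ⟨⟨s, hs, t, ht, rfl⟩, hn⟩
      exact ⟨⟨(∑ x ∈ s, x, ∑ x ∈ t, x), (s, t)⟩, ⟨by rw [← hn, hsum s hs t ht],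
        ⟨hs, rfl⟩, ⟨ht, rfl⟩⟩, rfl⟩
    · rintro ⟨⟨⟨i, j⟩, ⟨s, t⟩⟩, ⟨hn, ⟨hs, hi⟩, ⟨ht, hj⟩⟩, rfl⟩
      refine ⟨⟨s, hs, t, ht, rfl⟩, ?_⟩
      change ∑ x ∈ s ∪ t, x = n
      have hi' : ∑ x ∈ s, x = i := hi
      have hj' : ∑ x ∈ t, x = j := hj
      rw [hsum s hs t ht, hi', hj']
      exact hn
  rw [hset, Set.ncard_coe_finset, Finset.card_image_of_injOn, Finset.card_sigma]
  · simp [hUc, hWc, Finset.card_product]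
  · rintro ⟨⟨i, j⟩, ⟨s, t⟩⟩ h ⟨⟨i', j'⟩, ⟨s', t'⟩⟩ h' e
    simp only [Finset.coe_sigma, Set.mem_sigma_iff, Finset.mem_coe, Finset.HasAntidiagonal.mem_antidiagonal,
      Finset.mem_product, hU, hW, Set.Finite.mem_toFinset, Set.mem_inter_iff,
      Set.mem_ofPred_eq] at h h'
    obtain ⟨-, ⟨hs, hi⟩, ⟨ht, hj⟩⟩ := h
    obtain ⟨-, ⟨hs', hi'⟩, ⟨ht', hj'⟩⟩ := h'
    simp only at e
    have e1 : s = s' := by rw [← (hc s hs t ht).1, e, (hc s' hs' t' ht').1]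
    have e2 : t = t' := by rw [← (hc s hs t ht).2, e, (hc s' hs' t' ht').2]
    subst e1 e2 hi hi' hj hj'
    rfl

/-! ### Sets with prescribed gaps -/

/-- The `k`-element sets of numbers `≥ m` with the property `A`, any two elements of which are in
the relation `r`. -/
def spaced (r : ℕ → ℕ → Prop) (A : ℕ → Prop) (m k : ℕ) : Set (Finset ℕ) :=
  {u | u.card = k ∧ (∀ x ∈ u, ∀ y ∈ u, x < y → r x y) ∧ ∀ x ∈ u, m ≤ x ∧ A x}

section Spaced
variable {r : ℕ → ℕ → Prop} {A : ℕ → Prop}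

theorem gf_spaced_zero (m : ℕ) : gf (spaced r A m 0) = 1 := by
  rw [← gf_singleton_empty]
  congr 1
  ext u
  simp only [spaced, Set.mem_ofPred_eq, Finset.card_eq_zero, Set.mem_singleton_iff]
  constructor
  · exact fun h => h.1
  · rintro rfl
    simp

theorem spaced_congr {A' : ℕ → Prop} {m m' : ℕ} (h : ∀ x, m ≤ x ∧ A x ↔ m' ≤ x ∧ A' x) (k : ℕ) :
    spaced r A m k = spaced r A' m' k := by
  simp only [spaced, h]

/-- Split according to whether m belongs to the set. If it does, it is the smallest element, and the
gap condition at m only says that the others are at least `m'`. -/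
theorem gf_spaced_succ {m m' : ℕ} (hA : A m) (hm : m < m')
    (hr : ∀ y, A y → m < y → (r m y ↔ m' ≤ y)) (k : ℕ) :
    gf (spaced r A m (k + 1)) = gf (spaced r A (m + 1) (k + 1)) + q ^ m * gf (spaced r A m' k) := by
  have hmem : ∀ u ∈ spaced r A m' k, m ∉ u := fun u hu h => by
    have := (hu.2.2 m h).1
    omega
  rw [← gf_image (f := insert m) (m := m) (S := spaced r A m' k), ← gf_union]
  · congr 1
    ext u
    constructor
    · rintro ⟨h1, h2, h3⟩
      by_cases hu : m ∈ u
      · right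
        refine ⟨u.erase m, ⟨by rw [Finset.card_erase_of_mem hu, h1]; rfl, ?_, ?_⟩,
          Finset.insert_erase hu⟩
        · exact fun x hx y hy => h2 x (Finset.mem_of_mem_erase hx) y (Finset.mem_of_mem_erase hy)
        · intro x hx
          have hx' := Finset.mem_of_mem_erase hx
          have hlt : m < x := lt_of_le_of_ne (h3 x hx').1 (Finset.ne_of_mem_erase hx).symm
          exact ⟨(hr x (h3 x hx').2 hlt).1 (h2 m hu x hx' hlt), (h3 x hx').2⟩
      · left
        refine ⟨h1, h2, fun x hx => ⟨?_, (h3 x hx).2⟩⟩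
        have : x ≠ m := by rintro rfl; exact hu hx
        have := (h3 x hx).1
        omega
    · rintro (⟨h1, h2, h3⟩ | ⟨u, hu, rfl⟩)
      · exact ⟨h1, h2, fun x hx => ⟨by have := (h3 x hx).1; omega, (h3 x hx).2⟩⟩
      · refine ⟨by rw [Finset.card_insert_of_notMem (hmem u hu), hu.1], ?_, ?_⟩
        · intro x hx y hy hxy
          rw [Finset.mem_insert] at hx hy
          rcases hx with rfl | hx <;> rcases hy with rfl | hy
          · omega
          · exact (hr y (hu.2.2 y hy).2 hxy).2 (hu.2.2 y hy).1
          · have := (hu.2.2 x hx).1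
            omega
          · exact hu.2.1 x hx y hy hxy
        · intro x hx
          rw [Finset.mem_insert] at hx
          rcases hx with rfl | hx
          · exact ⟨le_rfl, hA⟩
          · exact ⟨by have := (hu.2.2 x hx).1; omega, (hu.2.2 x hx).2⟩
  · rw [Set.disjoint_left]
    rintro _ ⟨-, -, h⟩ ⟨u, -, rfl⟩
    have := (h m (Finset.mem_insert_self m u)).1
    omega
  · intro u hu v hv h
    rw [← Finset.erase_insert (hmem u hu), ← Finset.erase_insert (hmem v hv)]
    exact congrArg (fun t => Finset.erase t m) h
  · intro u hu
    rw [Finset.sum_insert (hmem u hu), add_comm]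

theorem gf_spaced_add (hr : ∀ x y, r (x + 15) (y + 15) ↔ r x y)
    (hA : ∀ x, A (x + 15) ↔ A x) (m k : ℕ) :
    gf (spaced r A (m + 15) k) = p ^ k * gf (spaced r A m k) := by
  rw [p, ← pow_mul, ← gf_image (f := fun u => u.map (addRightEmbedding 15))]
  · congr 1
    ext u
    constructor
    · rintro ⟨h1, h2, h3⟩
      have hu : (u.image (· - 15)).map (addRightEmbedding 15) = u := by
        rw [Finset.map_eq_image, Finset.image_image]
        conv_rhs => rw [← Finset.image_id (s := u)]
        refine Finset.image_congr fun x hx => ?_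
        have := (h3 x hx).1
        simp only [Function.comp, addRightEmbedding_apply, id]
        omega
      have hmem : ∀ x ∈ u.image (· - 15), x + 15 ∈ u := by
        intro x hx
        rw [← hu]
        exact Finset.mem_map_of_mem (addRightEmbedding 15) hx
      refine ⟨u.image (· - 15), ⟨?_, ?_, ?_⟩, hu⟩
      · rw [← h1]
        conv_rhs => rw [← hu, Finset.card_map]
      · intro x hx y hy hxy
        exact (hr x y).1 (h2 _ (hmem x hx) _ (hmem y hy) (by omega))
      · intro x hx
        have := h3 _ (hmem x hx)
        exact ⟨by omega, (hA x).1 this.2⟩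
    · rintro ⟨u, ⟨h1, h2, h3⟩, rfl⟩
      refine ⟨by rw [Finset.card_map, h1], ?_, ?_⟩
      · intro x hx y hy hxy
        simp only [Finset.mem_map, addRightEmbedding_apply] at hx hy
        obtain ⟨x, hx, rfl⟩ := hx
        obtain ⟨y, hy, rfl⟩ := hy
        exact (hr x y).2 (h2 x hx y hy (by omega))
      · intro x hx
        simp only [Finset.mem_map, addRightEmbedding_apply] at hx
        obtain ⟨x, hx, rfl⟩ := hx
        exact ⟨by have := (h3 x hx).1; omega, (hA x).2 (h3 x hx).2⟩
  · exact fun u _ v _ h => Finset.map_injective _ h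
  · intro u hu
    rw [Finset.sum_map]
    simp only [addRightEmbedding_apply, Finset.sum_add_distrib, Finset.sum_const, hu.1]
    simp [mul_comm]

end Spaced

/-! ### Parts that are not multiples of 15, without the boundary condition -/

theorem isNegPowClass_iff (m : ℕ) :
    IsNegPowClass m ↔ m % 15 = 7 ∨ m % 15 = 11 ∨ m % 15 = 13 ∨ m % 15 = 14 := by
  simp only [IsNegPowClass, Int.ModEq]
  omega

theorem isPosPowClass_iff (m : ℕ) :
    IsPosPowClass m ↔ m % 15 = 8 ∨ m % 15 = 4 ∨ m % 15 = 2 ∨ m % 15 = 1 := by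
  simp only [IsPosPowClass, Int.ModEq]
  omega

/-- The relation between two parts `x < y` that are not multiples of `15`. -/
def gapRel (x y : ℕ) : Prop := x + 15 ≤ y ∧ (y = x + 15 → IsNegPowClass x)

/-- The admissible residue classes for the parts that are not multiples of `15`. -/
def allowed (x : ℕ) : Prop := ¬ 15 ∣ x ∧ ¬ IsPosPowClass x

/-- The residue classes of the secondary colours. -/
def IsSecondary (x : ℕ) : Prop := allowed x ∧ ¬ IsNegPowClass x

instance (x : ℕ) : Decidable (IsSecondary x) := by
  unfold IsSecondary allowed; infer_instance

theorem isSecondary_iff (m : ℕ) : IsSecondary m ↔ m % 15 = 3 ∨ m % 15 = 5 ∨ m % 15 = 6 ∨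
    m % 15 = 9 ∨ m % 15 = 10 ∨ m % 15 = 12 := by
  simp only [IsSecondary, allowed, isNegPowClass_iff, isPosPowClass_iff]
  omega

theorem allowed_iff (m : ℕ) : allowed m ↔ m % 15 = 3 ∨ m % 15 = 5 ∨ m % 15 = 6 ∨ m % 15 = 7 ∨
    m % 15 = 9 ∨ m % 15 = 10 ∨ m % 15 = 11 ∨ m % 15 = 12 ∨ m % 15 = 13 ∨ m % 15 = 14 := by
  simp only [allowed, isPosPowClass_iff]
  omega

theorem gapRel_add (x y : ℕ) : gapRel (x + 15) (y + 15) ↔ gapRel x y := by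
  simp only [gapRel, isNegPowClass_iff]
  omega

theorem allowed_add (x : ℕ) : allowed (x + 15) ↔ allowed x := by
  simp only [allowed_iff]
  omega

/-- The coefficient of `Y ^ k`, weighted by `p ^ (k.choose 2)`. -/
noncomputable def wcoeff (h : PowerSeries (PowerSeries ℤ)) (k : ℕ) : PowerSeries ℤ :=
  p ^ (k.choose 2) * PowerSeries.coeff k h

theorem wcoeff_add (g h : PowerSeries (PowerSeries ℤ)) (k : ℕ) :
    wcoeff (g + h) k = wcoeff g k + wcoeff h k := by
  simp [wcoeff, mul_add]

/-- Adding a new smallest part: the factor p^k is the shift by 15 of the k parts above it. -/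
theorem wcoeff_K_mul_Y_mul (c : PowerSeries ℤ) (h : PowerSeries (PowerSeries ℤ)) (k : ℕ) :
    wcoeff (K c * Y * h) (k + 1) = c * (p ^ k * wcoeff h k) := by
  rw [wcoeff, wcoeff, mul_assoc, PowerSeries.coeff_C_mul, PowerSeries.coeff_succ_X_mul,
    Nat.choose_succ_succ' k 1, Nat.choose_one_right]
  ring

theorem wcoeff_rescale (h : PowerSeries (PowerSeries ℤ)) (k : ℕ) :
    wcoeff (PowerSeries.rescale p h) k = p ^ k * wcoeff h k := by
  rw [wcoeff, wcoeff, PowerSeries.coeff_rescale]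
  ring

/-- The product over the colours for the residue classes modulo `15`. -/
noncomputable def baseProd : PowerSeries (PowerSeries ℤ) :=
  colourProd (q ^ 7) (q ^ 11) (q ^ 13) (q ^ 14)

/-- The generating function of the admissible parts `≥ m`, for `m ≤ 16`. -/
noncomputable def tailSeries (m : ℕ) : PowerSeries (PowerSeries ℤ) :=
  (∏ x ∈ Finset.range m, if IsNegPowClass x then 1 - K (q ^ x) * Y else 1) *
    (∏ x ∈ Finset.Ico m 16, if IsSecondary x then 1 + K (q ^ x) * Y else 1) * baseProd

/-- Mirrors `gf_spaced_succ`: above a primary part m the next part may be m + 15, which the shift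
sends back to m. For a secondary m equality is excluded, so the remaining series starts at m + 1. -/
theorem tailSeries_of_isNegPowClass {m : ℕ} (hm : m < 16) (h : IsNegPowClass m) :
    tailSeries m = tailSeries (m + 1) + K (q ^ m) * Y * tailSeries m := by
  have h' : ¬ IsSecondary m := fun h' => h'.2 h
  rw [tailSeries, tailSeries, Finset.prod_range_succ, Finset.prod_eq_prod_Ico_succ_bot hm,
    if_pos h, if_neg h']
  ring

theorem tailSeries_of_isSecondary {m : ℕ} (hm : m < 16) (h : IsSecondary m) :
    tailSeries m = tailSeries (m + 1) + K (q ^ m) * Y * tailSeries (m + 1) := by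
  rw [tailSeries, tailSeries, Finset.prod_range_succ, Finset.prod_eq_prod_Ico_succ_bot hm,
    if_pos h, if_neg h.2]
  ring

theorem tailSeries_of_not_allowed {m : ℕ} (hm : m < 16) (h : ¬ allowed m) :
    tailSeries m = tailSeries (m + 1) := by
  have h1 : ¬ IsSecondary m := fun h' => h h'.1
  have h2 : ¬ IsNegPowClass m := by
    rw [allowed_iff] at h
    rw [isNegPowClass_iff]
    omega
  rw [tailSeries, tailSeries, Finset.prod_range_succ, Finset.prod_eq_prod_Ico_succ_bot hm,
    if_neg h1, if_neg h2]
  ring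

theorem rescale_colourProd (a b c d : PowerSeries ℤ) :
    (1 + K (a * b) * Y) * (1 + K (a * c) * Y) * (1 + K (a * d) * Y) *
        (1 + K (b * c) * Y) * (1 + K (b * d) * Y) * (1 + K (c * d) * Y) *
        PowerSeries.rescale p (colourProd a b c d) =
      (1 - K a * Y) * (1 - K b * Y) * (1 - K c * Y) * (1 - K d * Y) * colourProd a b c d := by
  rw [colourProd]
  simp only [map_mul (PowerSeries.rescale p), rescale_prodSeries, rescale_invSeries]
  rw [← invSeries_eq a, ← invSeries_eq b, ← invSeries_eq c, ← invSeries_eq d,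
    prodSeries_eq (a * b), prodSeries_eq (a * c), prodSeries_eq (a * d), prodSeries_eq (b * c),
    prodSeries_eq (b * d), prodSeries_eq (c * d)]
  generalize prodSeries (a * b * p) = Dab, prodSeries (a * c * p) = Dac,
    prodSeries (a * d * p) = Dad, prodSeries (b * c * p) = Dbc, prodSeries (b * d * p) = Dbd,
    prodSeries (c * d * p) = Dcd, invSeries a = Ea, invSeries b = Eb, invSeries c = Ec,
    invSeries d = Ed
  generalize 1 - K a * Y = ya, 1 - K b * Y = yb, 1 - K c * Y = yc, 1 - K d * Y = yd,
    1 + K (a * b) * Y = yab, 1 + K (a * c) * Y = yac, 1 + K (a * d) * Y = yad,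
    1 + K (b * c) * Y = ybc, 1 + K (b * d) * Y = ybd, 1 + K (c * d) * Y = ycd
  ring

theorem tailSeries_one : tailSeries 1 = (1 + K (q ^ 3) * Y) * (1 + K (q ^ 5) * Y) *
    (1 + K (q ^ 6) * Y) * (1 + K (q ^ 9) * Y) * (1 + K (q ^ 10) * Y) * (1 + K (q ^ 12) * Y) *
    baseProd := by
  simp [tailSeries, Finset.prod_Ico_succ_top, isNegPowClass_iff, isSecondary_iff]

theorem tailSeries_sixteen : tailSeries 16 = (1 - K (q ^ 7) * Y) * (1 - K (q ^ 11) * Y) *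
    (1 - K (q ^ 13) * Y) * (1 - K (q ^ 14) * Y) * baseProd := by
  simp [tailSeries, Finset.prod_range_succ, isNegPowClass_iff]

theorem tailSeries_fourteen : tailSeries 14 = (1 - K (q ^ 7) * Y) * (1 - K (q ^ 11) * Y) *
    (1 - K (q ^ 13) * Y) * baseProd := by
  simp [tailSeries, Finset.prod_range_succ, Finset.prod_Ico_succ_top, isNegPowClass_iff,
    isSecondary_iff]

theorem tailSeries_thirteen : tailSeries 13 = (1 - K (q ^ 7) * Y) * (1 - K (q ^ 11) * Y) *
    baseProd := by
  simp [tailSeries, Finset.prod_range_succ, Finset.prod_Ico_succ_top, isNegPowClass_iff,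
    isSecondary_iff]

theorem tailSeries_eleven : tailSeries 11 = (1 - K (q ^ 7) * Y) * (1 + K (q ^ 12) * Y) *
    baseProd := by
  simp [tailSeries, Finset.prod_range_succ, Finset.prod_Ico_succ_top, isNegPowClass_iff,
    isSecondary_iff]

theorem tailSeries_seven : tailSeries 7 = (1 + K (q ^ 9) * Y) * (1 + K (q ^ 10) * Y) *
    (1 + K (q ^ 12) * Y) * baseProd := by
  simp [tailSeries, Finset.prod_range_succ, Finset.prod_Ico_succ_top, isNegPowClass_iff,
    isSecondary_iff]

/-- The analogue of translating all parts by 15. It uses that each secondary product is p times the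
least positive number in its class, for instance q^7 q^11 = q^3 p. -/
theorem rescale_tailSeries : PowerSeries.rescale p (tailSeries 1) = tailSeries 16 := by
  have h := rescale_colourProd (q ^ 7) (q ^ 11) (q ^ 13) (q ^ 14)
  rw [← baseProd] at h
  rw [tailSeries_sixteen, ← h, tailSeries_one]
  simp only [map_mul (PowerSeries.rescale p), map_add (PowerSeries.rescale p), map_one, rescale_K,
    PowerSeries.rescale_X]
  simp only [← mul_assoc, ← map_mul, p, ← pow_add]

theorem wcoeff_tailSeries_zero {m : ℕ} : wcoeff (tailSeries m) 0 = 1 := by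
  simp [wcoeff, tailSeries, map_prod, baseProd, colourProd, prodSeries, invSeries, invPoch,
    apply_ite]

/-- The generating function of the sets of `k` admissible parts `≥ m`. -/
theorem gf_spaced_allowed (k : ℕ) : ∀ m ≤ 16,
    gf (spaced gapRel allowed m k) = wcoeff (tailSeries m) k := by
  induction k with
  | zero => exact fun m _ => by rw [gf_spaced_zero, wcoeff_tailSeries_zero]
  | succ k ih =>
    -- Both sides obey the same recursion in m, so by induction on k their difference does not
    -- depend on m.
    have step : ∀ m < 16,
        gf (spaced gapRel allowed m (k + 1)) - wcoeff (tailSeries m) (k + 1) =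
          gf (spaced gapRel allowed (m + 1) (k + 1)) - wcoeff (tailSeries (m + 1)) (k + 1) := by
      intro m hm
      by_cases h1 : IsNegPowClass m
      · have hA : allowed m := by
          rw [isNegPowClass_iff] at h1
          rw [allowed_iff]
          omega
        rw [gf_spaced_succ (m' := m + 15) hA (by omega)
          (fun y _ _ => ⟨fun h => h.1, fun h => ⟨h, fun _ => h1⟩⟩),
          gf_spaced_add gapRel_add allowed_add, ih m hm.le]
        have e := congrArg (wcoeff · (k + 1)) (tailSeries_of_isNegPowClass hm h1)
        simp only [wcoeff_add, wcoeff_K_mul_Y_mul] at e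
        rw [e]
        ring
      by_cases h2 : allowed m
      · rw [gf_spaced_succ (m' := m + 1 + 15) h2 (by omega)
          (fun y _ _ => by simp only [gapRel, h1, imp_false]; omega),
          gf_spaced_add gapRel_add allowed_add, ih (m + 1) hm]
        have e := congrArg (wcoeff · (k + 1)) (tailSeries_of_isSecondary hm ⟨h2, h1⟩)
        simp only [wcoeff_add, wcoeff_K_mul_Y_mul] at e
        rw [e]
        ring
      · rw [tailSeries_of_not_allowed hm h2, spaced_congr (A := allowed) (m := m) (m' := m + 1)]
        intro x
        constructor
        · rintro ⟨hx, hx'⟩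
          have : x ≠ m := by rintro rfl; exact h2 hx'
          exact ⟨by omega, hx'⟩
        · exact fun h => ⟨by omega, h.2⟩
    have const : ∀ m ≤ 16,
        gf (spaced gapRel allowed m (k + 1)) - wcoeff (tailSeries m) (k + 1) =
          gf (spaced gapRel allowed 16 (k + 1)) - wcoeff (tailSeries 16) (k + 1) := by
      intro m hm
      induction hm using Nat.decreasingInduction with
      | self => rfl
      | of_succ m hm ih' => rw [step m (by omega), ih']
    -- Passing from 1 to 16 also multiplies the difference by p^(k+1); being constant, it must
    -- vanish.
    have h16 : gf (spaced gapRel allowed 16 (k + 1)) - wcoeff (tailSeries 16) (k + 1) =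
        p ^ (k + 1) *
          (gf (spaced gapRel allowed 1 (k + 1)) - wcoeff (tailSeries 1) (k + 1)) := by
      rw [← rescale_tailSeries, wcoeff_rescale, show 16 = 1 + 15 from rfl,
        gf_spaced_add gapRel_add allowed_add, mul_sub]
    have h0 : (1 - p ^ (k + 1)) *
        (gf (spaced gapRel allowed 16 (k + 1)) - wcoeff (tailSeries 16) (k + 1)) = 0 := by
      rw [const 1 (by omega)] at h16
      linear_combination h16
    rcases mul_eq_zero.1 h0 with h | h
    · exact absurd h (one_sub_p_pow_ne_zero k)
    · exact fun m hm => sub_eq_zero.1 (by rw [const m hm, h])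

/-! ### The boundary condition on secondary parts -/

/-- The condition on a single part that is not a multiple of `15`. -/
def admissible (x : ℕ) : Prop := allowed x ∧ (¬ IsNegPowClass x → 15 < x)

theorem allowed_of_isNegPowClass {m : ℕ} (h : IsNegPowClass m) : allowed m := by
  rw [isNegPowClass_iff] at h
  rw [allowed_iff]
  omega

/-- Once the smallest part m is primary and positive, all others are at least m + 15 > 15, where
admissible and allowed coincide. -/
theorem gf_spaced_admissible_succ {m : ℕ} (hm : m < 16) (h : IsNegPowClass m) (k : ℕ) :
    gf (spaced gapRel admissible m (k + 1)) =
      gf (spaced gapRel admissible (m + 1) (k + 1)) +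
        wcoeff (K (q ^ m) * Y * tailSeries m) (k + 1) := by
  have hpos : m ≠ 0 := by
    rw [isNegPowClass_iff] at h
    omega
  rw [gf_spaced_succ (m' := m + 15) ⟨allowed_of_isNegPowClass h, fun h' => absurd h h'⟩ (by omega)
    (fun y _ _ => ⟨fun h => h.1, fun h' => ⟨h', fun _ => h⟩⟩),
    spaced_congr (A' := allowed) (m := m + 15) (m' := m + 15), gf_spaced_add gapRel_add allowed_add,
    gf_spaced_allowed k m hm.le, wcoeff_K_mul_Y_mul]
  exact fun x => ⟨fun h => ⟨h.1, h.2.1⟩, fun h => ⟨h.1, h.2, fun _ => by omega⟩⟩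

theorem spaced_admissible_eq {m m' : ℕ} (hm : m ≤ m') (hm' : m' ≤ 16)
    (h : ∀ x, m ≤ x → x < m' → ¬ IsNegPowClass x) (k : ℕ) :
    spaced gapRel admissible m k = spaced gapRel admissible m' k := by
  refine spaced_congr (fun x => ⟨fun hx => ⟨?_, hx.2⟩, fun hx => ⟨by omega, hx.2⟩⟩) k
  by_contra hlt
  have := hx.2.2 (h x hx.1 (by omega))
  omega

/-- The series of the sets of parts that are not multiples of `15` and do not contain `7`. -/
noncomputable def noSevenSeries : PowerSeries (PowerSeries ℤ) :=
  tailSeries 16 + K (q ^ 14) * Y * tailSeries 14 + K (q ^ 13) * Y * tailSeries 13 +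
    K (q ^ 11) * Y * tailSeries 11

/-- The series of the sets of parts that are not multiples of `15` and contain `7`. -/
noncomputable def sevenSeries : PowerSeries (PowerSeries ℤ) :=
  K (q ^ 7) * Y * tailSeries 7

theorem wcoeff_K_mul_Y_mul_zero (c : PowerSeries ℤ) (h : PowerSeries (PowerSeries ℤ)) :
    wcoeff (K c * Y * h) 0 = 0 := by
  simp [wcoeff]

/-- Classify by the smallest part: below 16 it can only be 11, 13 or 14, and from 16 on the boundary
condition is void. -/
theorem gf_spaced_admissible_eight (k : ℕ) :
    gf (spaced gapRel admissible 8 k) = wcoeff noSevenSeries k := by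
  simp only [noSevenSeries, wcoeff_add]
  rcases k with _ | k
  · simp only [wcoeff_K_mul_Y_mul_zero, wcoeff_tailSeries_zero, gf_spaced_zero, add_zero]
  · rw [spaced_admissible_eq (m := 8) (m' := 11) (by omega) (by omega)
      (fun x _ _ => by rw [isNegPowClass_iff]; omega),
      gf_spaced_admissible_succ (by omega) (by rw [isNegPowClass_iff]; omega),
      spaced_admissible_eq (m := 11 + 1) (m' := 13) (by omega) (by omega)
      (fun x _ _ => by rw [isNegPowClass_iff]; omega),
      gf_spaced_admissible_succ (by omega) (by rw [isNegPowClass_iff]; omega),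
      gf_spaced_admissible_succ (by omega) (by rw [isNegPowClass_iff]; omega),
      spaced_admissible_eq (m := 13 + 1 + 1) (m' := 16) (by omega) (by omega)
      (fun x _ _ => by rw [isNegPowClass_iff]; omega),
      spaced_congr (A' := allowed) (m' := 16), gf_spaced_allowed _ 16 le_rfl]
    exact fun x => ⟨fun h => ⟨h.1, h.2.1⟩, fun h => ⟨h.1, h.2, fun _ => by omega⟩⟩

/-- The admissible sets of `k` parts containing `7`. -/
def sevenSets (k : ℕ) : Set (Finset ℕ) := {u ∈ spaced gapRel admissible 0 k | 7 ∈ u}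

theorem spaced_admissible_eight (k : ℕ) :
    spaced gapRel admissible 8 k = {u ∈ spaced gapRel admissible 0 k | 7 ∉ u} := by
  rw [spaced_admissible_eq (m := 0) (m' := 7) (by omega) (by omega)
    (fun x _ _ => by rw [isNegPowClass_iff]; omega)]
  ext u
  constructor
  · rintro ⟨h1, h2, h3⟩
    exact ⟨⟨h1, h2, fun x hx => ⟨by have := (h3 x hx).1; omega, (h3 x hx).2⟩⟩,
      fun h => by have := (h3 7 h).1; omega⟩
  · rintro ⟨⟨h1, h2, h3⟩, h⟩
    refine ⟨h1, h2, fun x hx => ⟨?_, (h3 x hx).2⟩⟩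
    have h7 : x ≠ 7 := by rintro rfl; exact h hx
    have := (h3 x hx).1
    omega

theorem gf_sevenSets (k : ℕ) : gf (sevenSets k) = wcoeff sevenSeries k := by
  have h : gf (spaced gapRel admissible 0 k) =
      gf (spaced gapRel admissible 8 k) + gf (sevenSets k) := by
    rw [spaced_admissible_eight, ← gf_union]
    · congr 1
      ext u
      simp only [sevenSets, Set.mem_union, Set.mem_ofPred_eq]
      tauto
    · exact Set.disjoint_left.2 fun u hu hu' => hu.2 hu'.2
  rcases k with _ | k
  · rw [gf_spaced_zero, gf_spaced_zero] at h
    rw [sevenSeries, wcoeff_K_mul_Y_mul_zero]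
    linear_combination -h
  · rw [spaced_admissible_eq (m := 0) (m' := 7) (by omega) (by omega)
      (fun x _ _ => by rw [isNegPowClass_iff]; omega),
      gf_spaced_admissible_succ (by omega) (by rw [isNegPowClass_iff]; omega)] at h
    rw [sevenSeries]
    linear_combination -h

/-! ### Multiples of 15 and the full series in Y -/

theorem gf_spaced_multiples (k l : ℕ) :
    gf (spaced (fun x y => x + 60 ≤ y) (15 ∣ ·) (15 * l) k) =
      p ^ (l * k + 4 * k.choose 2) * invPoch k := by
  induction k generalizing l with
  | zero => simp [gf_spaced_zero, invPoch]
  | succ k ih =>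
    have h := gf_spaced_succ (r := fun x y => x + 60 ≤ y) (A := (15 ∣ ·)) (m := 15 * l)
      (m' := 15 * (l + 4)) (dvd_mul_right 15 l) (by omega) (fun y _ _ => by omega) k
    rw [ih, spaced_congr (A' := (15 ∣ ·)) (m := 15 * l + 1) (m' := 15 * l + 15)
      (fun x => by omega), gf_spaced_add (fun x y => by omega) (fun x => by omega), pow_mul,
      ← p] at h
    refine mul_left_cancel₀ (one_sub_p_pow_ne_zero k) ?_
    rw [mul_left_comm, one_sub_p_pow_mul_invPoch, Nat.choose_succ_succ' k 1, Nat.choose_one_right]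
    linear_combination h

/-- The sets of multiples of `15` with weight `2` for each element, differences at least `60` and
elements at least `15 * l`. -/
def multSets (l j : ℕ) : Set (Finset ℕ) :=
  {v | 2 * v.card = j ∧ (∀ x ∈ v, ∀ y ∈ v, x < y → x + 60 ≤ y) ∧
    ∀ x ∈ v, 15 * l ≤ x ∧ 15 ∣ x}

/-- Explains conditions (iv) and (v): gaps of 60 give 4 * k.choose 2, and the 30τ in the lower bound
gives the term 2ik. Thus a multiple of 15 weighs as much as two ordinary parts. -/
theorem choose_two_add_two_mul (i k : ℕ) :
    (i + 2 * k).choose 2 = i.choose 2 + (2 * i + 1) * k + 4 * k.choose 2 := by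
  induction k with
  | zero => simp
  | succ k ih =>
    rw [show i + 2 * (k + 1) = i + 2 * k + 1 + 1 by ring, Nat.choose_succ_succ' (i + 2 * k + 1) 1,
      Nat.choose_succ_succ' (i + 2 * k) 1, Nat.choose_succ_succ' k 1, ih]
    simp only [Nat.choose_one_right]
    ring

theorem gf_multSets (l i j : ℕ) :
    p ^ (i.choose 2) * gf (multSets (l + 1 + 2 * i) j) =
      p ^ ((i + j).choose 2) * PowerSeries.coeff j (invSqSeries (p ^ l)) := by
  rw [invSqSeries, PowerSeries.coeff_mk]
  split_ifs with h
  · obtain ⟨k, rfl⟩ := h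
    have e : multSets (l + 1 + 2 * i) (k + k) =
        spaced (fun x y => x + 60 ≤ y) (15 ∣ ·) (15 * (l + 1 + 2 * i)) k := by
      ext v
      simp only [multSets, spaced, Set.mem_ofPred_eq]
      refine and_congr_left fun _ => ?_
      omega
    rw [e, gf_spaced_multiples, show (k + k) / 2 = k by omega, ← two_mul,
      choose_two_add_two_mul]
    ring
  · have e : multSets (l + 1 + 2 * i) j = ∅ := by
      refine Set.eq_empty_of_forall_notMem fun v hv => h ⟨v.card, ?_⟩
      have := hv.1
      omega
    rw [e, gf_empty, mul_zero, mul_zero]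

/-- The series whose image under `Y ^ n ↦ p ^ (n.choose 2)` counts the partitions satisfying the
difference conditions. -/
noncomputable def gapSeries : PowerSeries (PowerSeries ℤ) :=
  sevenSeries * invSqSeries p + noSevenSeries * invSqSeries (p ^ 2)

theorem wcoeff_gapSeries (n : ℕ) : wcoeff gapSeries n =
    ∑ ij ∈ Finset.HasAntidiagonal.antidiagonal n,
      (gf (sevenSets ij.1) * gf (multSets (2 + 2 * ij.1) ij.2) +
        gf (spaced gapRel admissible 8 ij.1) * gf (multSets (3 + 2 * ij.1) ij.2)) := by
  rw [gapSeries, wcoeff_add, wcoeff, wcoeff, PowerSeries.coeff_mul, PowerSeries.coeff_mul,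
    Finset.mul_sum, Finset.mul_sum, ← Finset.sum_add_distrib]
  refine Finset.sum_congr rfl fun ij hij => ?_
  rw [← Finset.HasAntidiagonal.mem_antidiagonal.1 hij, gf_sevenSets, gf_spaced_admissible_eight,
    wcoeff, wcoeff]
  -- The bounds 30 + 30i (7 is a part) and 45 + 30i (7 is not) are 15(l + 1 + 2i) for l = 1 and l =
  -- 2.
  have h1 := gf_multSets 1 ij.1 ij.2
  have h2 := gf_multSets 2 ij.1 ij.2
  rw [pow_one] at h1
  linear_combination (-PowerSeries.coeff ij.1 sevenSeries) * h1 -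
    PowerSeries.coeff ij.1 noSevenSeries * h2

/-- The origin of `corr`: every tail series is a polynomial times `baseProd`, and `invSqSeries (p ^
2)` is 1 - pY² times `invSqSeries p`. Collecting the polynomials gives `corr` divided by p. -/
theorem K_p_mul_gapSeries : K p * gapSeries =
    corr (q ^ 7) (q ^ 11) (q ^ 13) (q ^ 14) p * fullProd (q ^ 7) (q ^ 11) (q ^ 13) (q ^ 14) p := by
  rw [gapSeries, fullProd, ← baseProd, sq p, ← invSqSeries_eq p, sevenSeries, noSevenSeries,
    tailSeries_sixteen, tailSeries_fourteen, tailSeries_thirteen, tailSeries_eleven,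
    tailSeries_seven, corr]
  generalize baseProd = F
  generalize invSqSeries p = G
  simp only [p, map_add, map_sub, map_mul, map_pow]
  generalize K q = x
  generalize Y = y
  ring

/-! ### From partitions to sets: the gap side -/

theorem card_partitions_eq {P : Multiset ℕ → Prop} [DecidablePred P]
    (hP : ∀ s, P s → s.Nodup ∧ 0 ∉ s) (n : ℕ) :
    ((Finset.univ.filter fun c : Nat.Partition n => P c.parts).card : ℤ) =
      PowerSeries.coeff n (gf {s | P s.val}) := by
  rw [gf, PowerSeries.coeff_mk, Nat.cast_inj, ← Set.ncard_coe_finset]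
  have hsum : ∀ s : Finset ℕ, ∑ x ∈ s, x = s.val.sum := fun s => by
    rw [Finset.sum, Multiset.map_id']
  refine Set.ncard_congr (fun c hc => ⟨c.parts, (hP _ (Finset.mem_filter.1 hc).2).1⟩) ?_ ?_ ?_
  · intro c hc
    exact ⟨(Finset.mem_filter.1 hc).2, (hsum _).trans c.parts_sum⟩
  · intro c c' hc hc' h
    exact Nat.Partition.ext (congrArg Finset.val h)
  · rintro s ⟨hs, hs'⟩
    have hpos : ∀ {i}, i ∈ s.val → 0 < i := fun {i} hi =>
      Nat.pos_of_ne_zero (by rintro rfl; exact (hP _ hs).2 hi)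
    exact ⟨⟨s.val, hpos, (hsum s).symm.trans hs'⟩, by simpa using hs, rfl⟩

theorem nodup_of_isGThree {s : Multiset ℕ} (h : IsGThree s) : s.Nodup := by
  rw [Multiset.nodup_iff_count_le_one]
  intro x
  by_contra! hx
  by_cases h15 : 15 ∣ x
  · have h1 : 1 < (multiplesPart s).count x := by
      rwa [multiplesPart, Multiset.count_filter_of_pos (p := (15 ∣ ·)) h15]
    have := h.gap_mult x (Multiset.count_pos.1 (by omega)) x
      (Multiset.count_pos.1 (by rw [Multiset.count_erase_self]; omega)) le_rfl
    omega
  · have h1 : 1 < (nonMultiplesPart s).count x := by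
      rwa [nonMultiplesPart, Multiset.count_filter_of_pos (p := (¬ 15 ∣ ·)) h15]
    have := (h.gap x (Multiset.count_pos.1 (by omega)) x
      (Multiset.count_pos.1 (by rw [Multiset.count_erase_self]; omega)) le_rfl).1
    omega

theorem not_isNegPowClass_zero : ¬ IsNegPowClass 0 := by
  simp [isNegPowClass_iff]

theorem isGThree_val_iff (s : Finset ℕ) : IsGThree s.val ↔
    (∀ x ∈ s.filter (¬ 15 ∣ ·), ∀ y ∈ s.filter (¬ 15 ∣ ·), x < y → gapRel x y) ∧
    (∀ x ∈ s.filter (¬ 15 ∣ ·), admissible x) ∧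
    (∀ x ∈ s.filter (15 ∣ ·), ∀ y ∈ s.filter (15 ∣ ·), x < y → x + 60 ≤ y) ∧
    ∀ x ∈ s.filter (15 ∣ ·),
      (if 7 ∈ s then 30 else 45) + 30 * (s.filter (¬ 15 ∣ ·)).card ≤ x := by
  have hm : multiplesPart s.val = (s.filter (15 ∣ ·)).val := rfl
  have hn : nonMultiplesPart s.val = (s.filter (¬ 15 ∣ ·)).val := rfl
  have herase : ∀ (t : Finset ℕ) (x y : ℕ), y ∈ t.val.erase x ↔ y ≠ x ∧ y ∈ t := fun t x y => by
    rw [t.nodup.mem_erase_iff]; rfl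
  constructor
  · intro h
    refine ⟨fun x hx y hy hxy => ?_, fun x hx => ?_, fun x hx y hy hxy => ?_, fun x hx => ?_⟩
    · obtain ⟨h1, h2⟩ := h.gap x (by rwa [hn]) y
        (by rw [hn, herase]; exact ⟨hxy.ne', hy⟩) hxy.le
      -- Parts that differ by exactly 15 lie in the same class, so testing the smaller one suffices.
      refine ⟨h1, fun e => ?_⟩
      have h3 := h2 e
      rw [isNegPowClass_iff, isNegPowClass_iff] at h3
      rw [isNegPowClass_iff]
      omega
    · rw [Finset.mem_filter] at hx
      exact ⟨⟨hx.2, h.not_pos x hx.1⟩, h.large x hx.1⟩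
    · exact h.gap_mult x (by rwa [hm]) y (by rw [hm, herase]; exact ⟨hxy.ne', hy⟩) hxy.le
    · exact h.lower x (by rwa [hm])
  · rintro ⟨h1, h2, h3, h4⟩
    refine ⟨fun x hx => ?_, fun x hx y hy hxy => ?_, fun x hx hx' => ?_, fun x hx y hy hxy => ?_,
      fun x hx => h4 x hx⟩
    · by_cases h15 : 15 ∣ x
      · rw [isPosPowClass_iff]
        omega
      · exact (h2 x (Finset.mem_filter.2 ⟨hx, h15⟩)).1.2
    · rw [hn, herase] at hy
      have := h1 x hx y hy.2 (lt_of_le_of_ne hxy hy.1.symm)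
      exact ⟨this.1, fun e => Or.inl (this.2 e)⟩
    · by_cases h15 : 15 ∣ x
      · have := h4 x (Finset.mem_filter.2 ⟨hx, h15⟩)
        split_ifs at this <;> omega
      · exact (h2 x (Finset.mem_filter.2 ⟨hx, h15⟩)).2 hx'
    · rw [hm, herase] at hy
      exact h3 x hx y hy.2 (lt_of_le_of_ne hxy hy.1.symm)

theorem nodup_and_zero_notMem_of_isPThree {s : Multiset ℕ} (h : IsPThree s) : s.Nodup ∧ 0 ∉ s :=
  ⟨h.1, fun h0 => not_isNegPowClass_zero (h.2 0 h0)⟩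

theorem nodup_and_zero_notMem_of_isGThree {s : Multiset ℕ} (h : IsGThree s) : s.Nodup ∧ 0 ∉ s :=
  ⟨nodup_of_isGThree h, fun h0 => by have := h.large 0 h0 not_isNegPowClass_zero; omega⟩

/-- The sets satisfying the difference conditions with `i` elements that are not multiples of `15`
and `j / 2` multiples of `15`. -/
def gapSets (i j : ℕ) : Set (Finset ℕ) :=
  {s | IsGThree s.val ∧ (s.filter (¬ 15 ∣ ·)).card = i ∧ 2 * (s.filter (15 ∣ ·)).card = j}

theorem filter_union_of_mem {u v : Finset ℕ} (hu : ∀ x ∈ u, ¬ 15 ∣ x) (hv : ∀ x ∈ v, 15 ∣ x) :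
    (u ∪ v).filter (¬ 15 ∣ ·) = u ∧ (u ∪ v).filter (15 ∣ ·) = v := by
  constructor <;>
  · ext x
    have h1 := hu x
    have h2 := hv x
    simp only [Finset.mem_filter, Finset.mem_union]
    tauto

/-- Once i and the presence of 7 are fixed, the lower bound is a constant, and the multiples of 15
can be chosen independently of the other parts. -/
theorem gapSets_eq (i j : ℕ) : gapSets i j =
    Set.image2 (· ∪ ·) (sevenSets i) (multSets (2 + 2 * i) j) ∪
      Set.image2 (· ∪ ·) (spaced gapRel admissible 8 i) (multSets (3 + 2 * i) j) := by
  rw [spaced_admissible_eight]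
  ext s
  constructor
  · rintro ⟨hs, rfl, rfl⟩
    obtain ⟨h1, h2, h3, h4⟩ := (isGThree_val_iff s).1 hs
    have hU : s.filter (¬ 15 ∣ ·) ∪ s.filter (15 ∣ ·) = s := by
      rw [Finset.union_comm, Finset.filter_union_filter_not_eq]
    have hu : s.filter (¬ 15 ∣ ·) ∈ spaced gapRel admissible 0 (s.filter (¬ 15 ∣ ·)).card :=
      ⟨rfl, h1, fun x hx => ⟨Nat.zero_le x, h2 x hx⟩⟩
    by_cases h7 : 7 ∈ s
    · refine Or.inl ⟨_, ⟨hu, by simp [h7]⟩, s.filter (15 ∣ ·), ⟨rfl, h3, fun x hx => ?_⟩, hU⟩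
      have := h4 x hx
      rw [if_pos h7] at this
      exact ⟨by omega, (Finset.mem_filter.1 hx).2⟩
    · refine Or.inr ⟨_, ⟨hu, by simp [h7]⟩, s.filter (15 ∣ ·), ⟨rfl, h3, fun x hx => ?_⟩, hU⟩
      have := h4 x hx
      rw [if_neg h7] at this
      exact ⟨by omega, (Finset.mem_filter.1 hx).2⟩
  · have key : ∀ u ∈ spaced gapRel admissible 0 i, ∀ l, ∀ v ∈ multSets l j,
        15 * l = (if 7 ∈ u then 30 else 45) + 30 * i → u ∪ v ∈ gapSets i j := by
      intro u hu l v hv hl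
      obtain ⟨e1, e2⟩ := filter_union_of_mem (fun x hx => (hu.2.2 x hx).2.1.1)
        (fun x hx => (hv.2.2 x hx).2)
      have e3 : 7 ∈ u ∪ v ↔ 7 ∈ u := by
        rw [Finset.mem_union, or_iff_left]
        intro h
        have := (hv.2.2 7 h).2
        omega
      refine ⟨(isGThree_val_iff _).2 ?_, by rw [e1, hu.1], by rw [e2, hv.1]⟩
      rw [e1, e2, hu.1]
      simp only [e3, ← hl]
      exact ⟨hu.2.1, fun x hx => (hu.2.2 x hx).2, hv.2.1, fun x hx => (hv.2.2 x hx).1⟩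
    rintro (⟨u, ⟨hu, h7⟩, v, hv, rfl⟩ | ⟨u, ⟨hu, h7⟩, v, hv, rfl⟩)
    · exact key u hu _ v hv (by rw [if_pos h7]; ring)
    · exact key u hu _ v hv (by rw [if_neg h7]; ring)

theorem gf_gapSets (i j : ℕ) : gf (gapSets i j) =
    gf (sevenSets i) * gf (multSets (2 + 2 * i) j) +
      gf (spaced gapRel admissible 8 i) * gf (multSets (3 + 2 * i) j) := by
  have hv : ∀ l, ∀ v ∈ multSets l j, ∀ x ∈ v, 15 ∣ x := fun l v hv x hx => (hv.2.2 x hx).2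
  have hu : ∀ u ∈ spaced gapRel admissible 0 i, ∀ x ∈ u, ¬ 15 ∣ x := fun u hu x hx =>
    (hu.2.2 x hx).2.1.1
  rw [gapSets_eq, gf_union, gf_image2_union (c := (15 ∣ ·)) (fun u h => hu u h.1) (hv _),
    gf_image2_union (c := (15 ∣ ·)) (fun u h => hu u (by
      rw [spaced_admissible_eight] at h
      exact h.1)) (hv _)]
  rw [spaced_admissible_eight, Set.disjoint_left]
  rintro _ ⟨u, ⟨hu1, h7⟩, v, hv1, rfl⟩ ⟨u', ⟨hu1', h7'⟩, v', hv1', e⟩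
  have e1 := (filter_union_of_mem (hu u hu1) (hv _ v hv1)).1
  have e2 := (filter_union_of_mem (hu u' hu1') (hv _ v' hv1')).1
  simp only at e
  rw [← e, e2] at e1
  exact h7' (e1 ▸ h7)

/-- The truncation loses nothing at q^n: parts are positive, so the degree in Y, at most twice the
number of parts, is at most 2n. -/
theorem coeff_lam_gapSeries {n B : ℕ} (hB : 2 * n < B) :
    PowerSeries.coeff n (lam B gapSeries) = GThree n := by
  rw [GThree, card_partitions_eq (fun _ => nodup_and_zero_notMem_of_isGThree)]
  have hl : lam B gapSeries = gf (⋃ z ∈ (Finset.range B).sigma fun N =>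
      Finset.HasAntidiagonal.antidiagonal N, gapSets z.2.1 z.2.2) := by
    rw [gf_biUnion, Finset.sum_sigma]
    · refine Finset.sum_congr rfl fun N _ => ?_
      simp only [gf_gapSets]
      exact wcoeff_gapSeries N
    · rintro ⟨N, i, j⟩ hz ⟨N', i', j'⟩ hz' hne
      refine Set.disjoint_left.2 ?_
      rintro s ⟨-, h1, h2⟩ ⟨-, h1', h2'⟩
      simp only [Finset.coe_sigma, Set.mem_sigma_iff, Finset.mem_coe,
        Finset.HasAntidiagonal.mem_antidiagonal] at hz hz' h1 h2 h1' h2'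
      subst h1 h2 h1' h2'
      obtain ⟨-, rfl⟩ := hz
      obtain ⟨-, rfl⟩ := hz'
      exact hne rfl
  rw [hl, gf, gf, PowerSeries.coeff_mk, PowerSeries.coeff_mk]
  congr 2
  ext s
  refine and_congr_left fun hs => ?_
  simp only [Set.mem_iUnion, Finset.mem_sigma, Finset.mem_range,
    Finset.HasAntidiagonal.mem_antidiagonal, exists_prop]
  constructor
  · rintro ⟨z, -, hz⟩
    exact hz.1
  · intro h
    refine ⟨⟨(s.filter (¬ 15 ∣ ·)).card + 2 * (s.filter (15 ∣ ·)).card,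
      (s.filter (¬ 15 ∣ ·)).card, 2 * (s.filter (15 ∣ ·)).card⟩, ⟨?_, rfl⟩, h, rfl, rfl⟩
    have h1 : s.card ≤ n := by
      have hs' : ∑ x ∈ s, x = n := hs
      rw [← hs', Finset.card_eq_sum_ones]
      refine Finset.sum_le_sum fun x hx => Nat.one_le_iff_ne_zero.2 ?_
      rintro rfl
      exact (nodup_and_zero_notMem_of_isGThree h).2 hx
    have h2 := Finset.card_filter_add_card_filter_not (s := s) (fun x => 15 ∣ x)
    simp only
    omega

/-! ### The product side and the conclusion -/

theorem prod_range_eq (m : ℕ) :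
    ∏ t ∈ Finset.range m, ((1 + q ^ 7 * p ^ t) * (1 + q ^ 11 * p ^ t) * (1 + q ^ 13 * p ^ t) *
      (1 + q ^ 14 * p ^ t)) = ∏ x ∈ (Finset.range (15 * m)).filter IsNegPowClass, (1 + q ^ x) := by
  rw [Finset.prod_filter]
  induction m with
  | zero => simp
  | succ m ih =>
    rw [Finset.prod_range_succ, ih, Nat.mul_succ, Finset.prod_range_add]
    congr 1
    simp [Finset.prod_range_succ, isNegPowClass_iff, p, ← pow_mul, ← pow_add,
      add_comm]

theorem coeff_prod_one_add_pow {n m : ℕ} (hm : n < 15 * m) :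
    PowerSeries.coeff n (∏ x ∈ (Finset.range (15 * m)).filter IsNegPowClass, (1 + q ^ x)) =
      (PThree n : ℤ) := by
  rw [PThree, card_partitions_eq (fun _ => nodup_and_zero_notMem_of_isPThree), gf, PowerSeries.coeff_mk,
    Finset.prod_one_add, map_sum]
  have h : ({s | IsPThree s.val} ∩ {s | ∑ x ∈ s, x = n} : Set (Finset ℕ)) =
      (((Finset.range (15 * m)).filter IsNegPowClass).powerset.filter
        fun s => ∑ x ∈ s, x = n : Finset (Finset ℕ)) := by
    ext s
    simp only [Set.mem_inter_iff, Set.mem_ofPred_eq, Finset.coe_filter, Finset.mem_powerset]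
    refine and_congr_left fun hs => ?_
    constructor
    · intro h x hx
      have : x ≤ ∑ y ∈ s, y :=
        Finset.single_le_sum (f := fun y => y) (fun _ _ => Nat.zero_le _) hx
      exact Finset.mem_filter.2 ⟨Finset.mem_range.2 (by omega), h.2 x hx⟩
    · exact fun h => ⟨s.nodup, fun x hx => (Finset.mem_filter.1 (h hx)).2⟩
  rw [h, Set.ncard_coe_finset, Finset.card_filter]
  push_cast
  refine Finset.sum_congr rfl fun s _ => ?_
  rw [Finset.prod_pow_eq_pow_sum, q, PowerSeries.coeff_X_pow]
  simp only [eq_comm]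

theorem p_pow_dvd_lam_gapSeries_sub (m : ℕ) :
    p ^ m ∣ lam (m + 1 + 4) gapSeries -
      ∏ x ∈ (Finset.range (15 * (m + 1))).filter IsNegPowClass, (1 + q ^ x) := by
  -- The exponent m + 1 leaves p^m after the common factor p is cancelled.
  have h := lam_corr_mul_fullProd (m + 1) (a := q ^ 7) (b := q ^ 11) (c := q ^ 13) (d := q ^ 14)
    (ε := p) (by rw [p]; ring)
  rwa [← K_p_mul_gapSeries, lam_K_mul, ← mul_sub, pow_succ', mul_dvd_mul_iff_left p_ne_zero,
    prod_range_eq] at h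

end GollnitzFour

open GollnitzFour in
theorem theorem3 (n : ℕ) : GThree n = PThree n := by
  -- With 2n + 1 the truncation degree 2n + 6 exceeds 2n, and both the modulus and the range of the
  -- finite product reach beyond q^n.
  have h := p_pow_dvd_lam_gapSeries_sub (2 * n + 1)
  have hp : p ^ (2 * n + 1) = PowerSeries.X ^ (15 * (2 * n + 1)) := by rw [p, q, ← pow_mul]
  rw [hp] at h
  have h0 := PowerSeries.X_pow_dvd_iff.1 h n (by omega)
  rw [map_sub, coeff_lam_gapSeries (by omega), coeff_prod_one_add_pow (by omega)] at h0
  exact_mod_cast sub_eq_zero.1 h0
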